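/- Let $\mathbb{D}=\{\lambda\in\mathbb{C}:|\lambda|<1\}$. Given a concave function $\psi:\mathbb{D}\to[0,\infty)$, there exist a compact set $A\subset\mathbb{C}$ and a map $f:\mathbb{D}\times A\to\mathbb{C}$ that is a holomorphic motion of $A$, i.e. 1. for each fixed $z\in A$, the map $\lambda\mapsto f(\lambda,z)$ is holomorphic on $\mathbb{D}$; 2. for each fixed $\lambda\in\mathbb{D}$, the map $z\mapsto f(\lambda,z)$ is injective on $A$; 3. $f(0,z)=z$ for all $z\in A$, such that, setting $A_\lambda:=\{f(\lambda,z):z\in A\}$, we have $$\dim_H(A_\lambda)=\dim_P(A_\lambda)=\frac{2}{1+\psi(\lambda)}\qquad(\lambda\in\mathbb{D}),$$ where $\dim_H$ and $\dim_P$ denote Hausdorff and packing dimension. -/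

import Mathlib

open Set Metric
open scoped ENNReal NNReal

/-- `f` restricts to a holomorphic motion `𝔻 × A → ℂ` of the set `A`; only the values `f w z` with
`w` in the open unit disk and `z ∈ A` are constrained. -/
structure IsHolomorphicMotion (A : Set ℂ) (f : ℂ → ℂ → ℂ) : Prop where
  holomorphic : ∀ z ∈ A, DifferentiableOn ℂ (fun w => f w z) (ball 0 1)
  injective : ∀ w ∈ ball (0 : ℂ) 1, InjOn (f w) A
  identity : ∀ z ∈ A, f 0 z = z

/-- A finite set of pairwise disjoint closed disks, given by their centres and positive radii, with
centres in `A` and diameters at most `δ`. -/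
structure IsDiskPacking (δ : ℝ) (A : Set ℂ) (F : Finset (ℂ × ℝ)) : Prop where
  center_mem : ∀ p ∈ F, p.1 ∈ A
  radius_pos : ∀ p ∈ F, 0 < p.2
  diam_le : ∀ p ∈ F, 2 * p.2 ≤ δ
  disjoint : (F : Set (ℂ × ℝ)).PairwiseDisjoint fun p => closedBall p.1 p.2

/-- The supremum of `∑ diam(D_j) ^ s` over all finite packings at scale `δ`. -/
noncomputable def packingContent (s : ℝ≥0) (δ : ℝ) (A : Set ℂ) : ℝ≥0∞ :=
  ⨆ (F : Finset (ℂ × ℝ)) (_ : IsDiskPacking δ A F),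
    ∑ p ∈ F, ENNReal.ofReal (2 * p.2) ^ (s : ℝ)

/-- The `s`-dimensional pre-packing measure. As `packingContent s δ A` is monotone in `δ`, its limit
as `δ → 0` is the infimum over `δ > 0`. -/
noncomputable def prePackingMeasure (s : ℝ≥0) (A : Set ℂ) : ℝ≥0∞ :=
  ⨅ (δ : ℝ) (_ : 0 < δ), packingContent s δ A

/-- The `s`-dimensional packing measure (an outer measure). -/
noncomputable def packingMeasure (s : ℝ≥0) (A : Set ℂ) : ℝ≥0∞ :=
  ⨅ (B : ℕ → Set ℂ) (_ : A = ⋃ j, B j), ∑' j, prePackingMeasure s (B j)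

/-- The packing dimension of a plane set: the threshold exponent below which the packing measure
is infinite and above which it vanishes (the analogue of Mathlib's `dimH`). -/
noncomputable def dimP (A : Set ℂ) : ℝ≥0∞ :=
  ⨆ (s : ℝ≥0) (_ : packingMeasure s A = ∞), (s : ℝ≥0∞)

/-!
A nonnegative concave function `ψ` on the disk is the infimum of countably many affine functions
`a_k = Re α_k` with `α_k` holomorphic, and these can be chosen with `a_k ≥ ψ + ε_k` for some
`ε_k > 0` (`ConcaveOn.exists_seq_differentiable_re_gt`). As both dimensions of a countable union are
suprema, and `2 / (1 + ψ)` is the supremum of the `2 / (1 + a_k)`, it is enough to realize each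
`2 / (1 + a_k)` by a holomorphic motion of a compact set that stays in a prescribed disk, and to
take these disks disjoint and shrinking to a point, which is added to the union.

For one affine function bounded below by `ε > 0`, take the self-similar set of all sums
`∑ ρ ^ j * t_j` whose digits `t_j` run over an `m × m` square of Gaussian integers, with the
holomorphically varying ratio `ρ = m ^ (-(1 + α))` (`exists_holomorphic_coding`). If `m ^ ε ≥ 8`
then `‖ρ‖ ≤ 1 / (8 * m)` on the whole disk, so the first differing digit of two codes determines
the distance of the points up to a constant factor (`IsGeometricCoding`), and the similarity
dimension is `log (m ^ 2) / log (1 / ‖ρ‖) = 2 / (1 + Re α)`.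

That this exponent `s` is at most the Hausdorff dimension follows by reading codes as expansions in
base `m ^ 2`, which maps the set onto `[0, 1]` by an `s`-Hölder map
(`IsGeometricCoding.le_dimH_range`). That the packing dimension is at most `s` follows by comparing
packing sums with the Bernoulli measure of cylinders
(`IsGeometricCoding.packingContent_range_ne_top`). The general inequality `dimH_le_dimP` closes the
circle.
-/

/-! ### Packing measures and packing dimension -/

theorem packingContent_mono_scale (s : ℝ≥0) {δ ε : ℝ} (h : δ ≤ ε) (A : Set ℂ) :
    packingContent s δ A ≤ packingContent s ε A := by
  refine iSup₂_le fun F hF => ?_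
  have hF' : IsDiskPacking ε A F :=
    ⟨hF.center_mem, hF.radius_pos, fun p hp => (hF.diam_le p hp).trans h, hF.disjoint⟩
  exact le_iSup₂ (f := fun F (_ : IsDiskPacking ε A F) =>
    ∑ p ∈ F, ENNReal.ofReal (2 * p.2) ^ (s : ℝ)) F hF'

theorem packingContent_le_rpow_mul {s t : ℝ≥0} (hst : s ≤ t) (δ : ℝ) (A : Set ℂ) :
    packingContent t δ A ≤ ENNReal.ofReal δ ^ ((t - s : ℝ≥0) : ℝ) * packingContent s δ A := by
  refine iSup₂_le fun F hF => ?_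
  calc ∑ p ∈ F, ENNReal.ofReal (2 * p.2) ^ (t : ℝ)
      ≤ ∑ p ∈ F, ENNReal.ofReal δ ^ ((t - s : ℝ≥0) : ℝ) * ENNReal.ofReal (2 * p.2) ^ (s : ℝ) := by
        refine Finset.sum_le_sum fun p hp => ?_
        have : (t : ℝ) = ((t - s : ℝ≥0) : ℝ) + (s : ℝ) := by
          rw [← NNReal.coe_add, tsub_add_cancel_of_le hst]
        rw [this, ENNReal.rpow_add_of_nonneg _ _ (NNReal.coe_nonneg _) (NNReal.coe_nonneg _)]
        gcongr
        exact hF.diam_le p hp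
    _ = ENNReal.ofReal δ ^ ((t - s : ℝ≥0) : ℝ) * ∑ p ∈ F, ENNReal.ofReal (2 * p.2) ^ (s : ℝ) := by
        rw [Finset.mul_sum]
    _ ≤ _ := by
        gcongr
        exact le_iSup₂ (f := fun F (_ : IsDiskPacking δ A F) =>
          ∑ p ∈ F, ENNReal.ofReal (2 * p.2) ^ (s : ℝ)) F hF

open Filter Topology in
/-- Bounded packing sums at an exponent force the pre-packing measure to vanish at every larger
one. -/
theorem prePackingMeasure_eq_zero_of_lt {s t : ℝ≥0} (hst : s < t) {A : Set ℂ}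
    (hA : packingContent s 1 A ≠ ∞) : prePackingMeasure t A = 0 := by
  have hpos : 0 < ((t - s : ℝ≥0) : ℝ) := by exact_mod_cast tsub_pos_of_lt hst
  have hlim : Tendsto (fun δ : ℝ => ENNReal.ofReal δ ^ ((t - s : ℝ≥0) : ℝ) * packingContent s 1 A)
      (𝓝[>] 0) (𝓝 0) := by
    have h1 : Tendsto (fun δ : ℝ => ENNReal.ofReal δ ^ ((t - s : ℝ≥0) : ℝ)) (𝓝[>] 0) (𝓝 0) := by
      have : Continuous (fun δ : ℝ => ENNReal.ofReal δ ^ ((t - s : ℝ≥0) : ℝ)) :=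
        ENNReal.continuous_rpow_const.comp ENNReal.continuous_ofReal
      have h := this.tendsto 0
      rw [ENNReal.ofReal_zero, ENNReal.zero_rpow_of_pos hpos] at h
      exact h.mono_left nhdsWithin_le_nhds
    simpa using ENNReal.Tendsto.mul_const h1 (Or.inr hA)
  refine le_antisymm (ge_of_tendsto hlim ?_) bot_le
  filter_upwards [Ioo_mem_nhdsGT (zero_lt_one' ℝ)] with δ hδ
  calc prePackingMeasure t A ≤ packingContent t δ A := iInf₂_le δ hδ.1
    _ ≤ _ := packingContent_le_rpow_mul hst.le δ A
    _ ≤ _ := by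
      gcongr
      exact packingContent_mono_scale s hδ.2.le A

theorem packingContent_singleton_ne_top (s : ℝ≥0) (x : ℂ) : packingContent s 1 {x} ≠ ∞ := by
  refine ne_top_of_le_ne_top ENNReal.one_ne_top (iSup₂_le fun F hF => ?_)
  have hcard : F.card ≤ 1 := by
    refine Finset.card_le_one.2 fun p hp q hq => ?_
    by_contra hpq
    refine Set.disjoint_left.1 (hF.disjoint hp hq hpq)
      (mem_closedBall_self (hF.radius_pos p hp).le) ?_
    rw [hF.center_mem p hp, ← mem_singleton_iff.1 (hF.center_mem q hq)]
    exact mem_closedBall_self (hF.radius_pos q hq).le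
  calc ∑ p ∈ F, ENNReal.ofReal (2 * p.2) ^ (s : ℝ) ≤ ∑ p ∈ F, 1 := by
        refine Finset.sum_le_sum fun p hp => ENNReal.rpow_le_one ?_ s.2
        exact ENNReal.ofReal_le_one.2 (hF.diam_le p hp)
    _ ≤ 1 := by simpa using hcard

/-- Centres of a separated family are centres of a packing by disks of a common radius. -/
theorem card_mul_le_packingContent (t : ℝ≥0) {ε : ℝ} (hε : 0 < ε) {B : Set ℂ} (G : Finset ℂ)
    (hGB : (G : Set ℂ) ⊆ B) (hG : IsSeparated (ENNReal.ofReal ε) (G : Set ℂ)) :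
    G.card * ENNReal.ofReal ε ^ (t : ℝ) ≤ packingContent t ε B := by
  classical
  have hinj : Function.Injective (fun x : ℂ => (x, ε / 2)) := fun x y h => congrArg Prod.fst h
  have hF : IsDiskPacking ε B (G.map ⟨_, hinj⟩) := by
    refine ⟨?_, ?_, ?_, ?_⟩
    · intro p hp
      obtain ⟨x, hx, rfl⟩ := Finset.mem_map.1 hp
      exact hGB hx
    · intro p hp
      obtain ⟨x, hx, rfl⟩ := Finset.mem_map.1 hp
      exact half_pos hε
    · intro p hp
      obtain ⟨x, hx, rfl⟩ := Finset.mem_map.1 hp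
      exact (mul_div_cancel₀ ε two_ne_zero).le
    · intro p hp q hq hpq
      obtain ⟨x, hx, rfl⟩ := Finset.mem_map.1 (Finset.mem_coe.1 hp)
      obtain ⟨y, hy, rfl⟩ := Finset.mem_map.1 (Finset.mem_coe.1 hq)
      have hxy : x ≠ y := fun h => hpq (by rw [h])
      have h : ENNReal.ofReal ε < edist x y := hG hx hy hxy
      rw [edist_dist, ENNReal.ofReal_lt_ofReal_iff_of_nonneg hε.le] at h
      exact closedBall_disjoint_closedBall (by simpa using h)
  refine le_trans (le_of_eq ?_) (le_iSup₂ (f := fun F (_ : IsDiskPacking ε B F) =>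
    ∑ p ∈ F, ENNReal.ofReal (2 * p.2) ^ (t : ℝ)) _ hF)
  rw [Finset.sum_map]
  simp only [Function.Embedding.coeFn_mk, mul_div_cancel₀ ε two_ne_zero, Finset.sum_const,
    nsmul_eq_mul]

/-- A maximal separated subset of `B` is a finite cover whose cardinality is controlled by the
packing content. -/
theorem exists_finset_cover_of_packingContent_ne_top (t : ℝ≥0) {ε : ℝ} (hε : 0 < ε) {B : Set ℂ}
    (hB : packingContent t ε B ≠ ∞) :
    ∃ G : Finset ℂ, B ⊆ ⋃ x ∈ G, closedBall x ε ∧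
      G.card * ENNReal.ofReal ε ^ (t : ℝ) ≤ packingContent t ε B := by
  classical
  have hcoe : ((ε.toNNReal : ℝ≥0) : ℝ≥0∞) = ENNReal.ofReal ε := rfl
  have hpos : ENNReal.ofReal ε ^ (t : ℝ) ≠ 0 := by
    have : 0 < ENNReal.ofReal ε ^ (t : ℝ) :=
      ENNReal.rpow_pos (ENNReal.ofReal_pos.2 hε) ENNReal.ofReal_ne_top
    exact this.ne'
  have hnum : packingNumber ε.toNNReal B ≠ ⊤ := by
    intro htop
    obtain ⟨N, hN⟩ := ENNReal.exists_nat_gt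
      (ENNReal.div_ne_top hB hpos)
    have hlt : (N : ℕ∞) < packingNumber ε.toNNReal B := by rw [htop]; exact ENat.natCast_lt_top N
    simp only [packingNumber, lt_iSup_iff] at hlt
    obtain ⟨C, hCB, hC, hNC⟩ := hlt
    obtain ⟨D, hDC, hD⟩ := exists_subset_encard_eq hNC.le
    have hDfin : D.Finite := finite_of_encard_eq_coe hD
    have hcard : hDfin.toFinset.card = N := by
      rw [hDfin.encard_eq_coe_toFinset_card] at hD
      exact_mod_cast hD
    have h := card_mul_le_packingContent t hε hDfin.toFinset
      (by simpa using hDC.trans hCB) (by simpa using! hC.subset hDC)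
    rw [hcard] at h
    refine hN.not_ge ((ENNReal.le_div_iff_mul_le (Or.inl hpos) (Or.inr hB)).2 h)
  have hfin : (maximalSeparatedSet ε.toNNReal B).Finite := by
    rw [← encard_ne_top_iff, encard_maximalSeparatedSet hnum]
    exact hnum
  refine ⟨hfin.toFinset, ?_, card_mul_le_packingContent t hε _ ?_ ?_⟩
  · have h := isCover_iff_subset_iUnion_closedEBall.1 (isCover_maximalSeparatedSet hnum)
    simpa [hcoe, closedEBall_ofReal hε.le] using h
  · simpa using maximalSeparatedSet_subset
  · simpa using! isSeparated_maximalSeparatedSet (ε := ε.toNNReal) (A := B)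

open MeasureTheory Filter Topology in
/-- A maximal separated set yields at once a packing by disks of diameter `ε` and a cover by disks
of radius `ε`; the factor `2 ^ t` is the price of doubling the diameters. -/
theorem hausdorffMeasure_le_prePackingMeasure (t : ℝ≥0) (B : Set ℂ) :
    μH[t] B ≤ 2 ^ (t : ℝ) * prePackingMeasure t B := by
  have htwo : (2 : ℝ≥0∞) ^ (t : ℝ) ≠ ∞ := ENNReal.rpow_ne_top_of_nonneg t.2 (by simp)
  have htwo' : (2 : ℝ≥0∞) ^ (t : ℝ) ≠ 0 := (ENNReal.rpow_pos (by simp) (by simp)).ne'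
  rw [prePackingMeasure, ENNReal.mul_iInf_of_ne htwo' htwo]
  refine le_iInf fun δ => ?_
  rw [ENNReal.mul_iInf_of_ne htwo' htwo]
  refine le_iInf fun hδ => ?_
  by_cases hB : packingContent t δ B = ∞
  · simp [hB, ENNReal.mul_top htwo']
  let ε : ℕ → ℝ := fun j => δ / (j + 1)
  have hε : ∀ j, 0 < ε j := fun j => by positivity
  have hεδ : ∀ j, ε j ≤ δ := fun j => div_le_self hδ.le (by simp)
  have hle : ∀ j, packingContent t (ε j) B ≤ packingContent t δ B :=
    fun j => packingContent_mono_scale t (hεδ j) B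
  choose G hG hGcard using fun j =>
    exists_finset_cover_of_packingContent_ne_top t (hε j) (ne_top_of_le_ne_top hB (hle j))
  have hdiam : ∀ j (x : ℂ), ediam (closedBall x (ε j)) ≤ 2 * ENNReal.ofReal (ε j) := by
    intro j x
    rw [← closedEBall_ofReal (hε j).le]
    exact ediam_closedEBall_le
  have hlim : Tendsto (fun j => 2 * ENNReal.ofReal (ε j)) atTop (𝓝 0) := by
    have h0 : Tendsto ε atTop (𝓝 0) := by
      simpa [ε, div_eq_mul_inv] using
        (tendsto_one_div_add_atTop_nhds_zero_nat (𝕜 := ℝ)).const_mul δ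
    have := ENNReal.Tendsto.const_mul (a := 2) (ENNReal.tendsto_ofReal h0) (Or.inr (by simp))
    simpa using this
  refine (Measure.hausdorffMeasure_le_liminf_sum (t : ℝ) B _ hlim
    (fun j (x : G j) => closedBall (x : ℂ) (ε j)) (Eventually.of_forall fun j x => hdiam j x)
    (Eventually.of_forall fun j => ?_)).trans ?_
  · simpa [iUnion_subtype] using hG j
  · refine liminf_le_of_frequently_le' (Frequently.of_forall fun j => ?_)
    calc ∑ x : G j, ediam (closedBall (x : ℂ) (ε j)) ^ (t : ℝ)
        ≤ ∑ _x : G j, (2 * ENNReal.ofReal (ε j)) ^ (t : ℝ) := by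
          gcongr with x
          exact hdiam j x
      _ = 2 ^ (t : ℝ) * ((G j).card * ENNReal.ofReal (ε j) ^ (t : ℝ)) := by
          rw [ENNReal.mul_rpow_of_nonneg _ _ (NNReal.coe_nonneg t)]
          simp [mul_left_comm]
      _ ≤ 2 ^ (t : ℝ) * packingContent t δ B := by
          gcongr
          exact (hGcard j).trans (hle j)

open MeasureTheory in
theorem dimH_le_dimP (A : Set ℂ) : dimH A ≤ dimP A := by
  refine dimH_le fun t ht => le_iSup₂_of_le t ?_ le_rfl
  refine iInf₂_eq_top.2 fun B hB => ?_
  by_contra hne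
  have htwo : (2 : ℝ≥0∞) ^ (t : ℝ) ≠ ∞ := ENNReal.rpow_ne_top_of_nonneg t.2 (by simp)
  have h : μH[t] A ≤ 2 ^ (t : ℝ) * ∑' j, prePackingMeasure t (B j) := by
    rw [hB, ← ENNReal.tsum_mul_left]
    exact (measure_iUnion_le B).trans
      (ENNReal.tsum_le_tsum fun j => hausdorffMeasure_le_prePackingMeasure t (B j))
  rw [ht, top_le_iff] at h
  exact ENNReal.mul_ne_top htwo hne h

/-- It is the vanishing of the pre-packing measures, and not only their finiteness, that survives
an infinite sum; hence the bound is asked for all exponents above `d`. -/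
theorem dimP_iUnion_le {B : ℕ → Set ℂ} {d : ℝ≥0}
    (hB : ∀ t : ℝ≥0, d < t → ∀ j, prePackingMeasure t (B j) = 0) : dimP (⋃ j, B j) ≤ d := by
  refine iSup₂_le fun t ht => ?_
  by_contra! hlt
  have h : packingMeasure t (⋃ j, B j) ≤ ∑' j, prePackingMeasure t (B j) :=
    iInf₂_le (f := fun (B' : ℕ → Set ℂ) (_ : (⋃ j, B j) = ⋃ j, B' j) =>
      ∑' j, prePackingMeasure t (B' j)) B rfl
  simp [ht, hB t (by exact_mod_cast hlt)] at h

/-! ### Dimensions of sets coded by sequences of digits -/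

theorem exists_first_ne {α : Type*} {x y : ℕ → α} (h : x ≠ y) :
    ∃ k, (∀ j < k, x j = y j) ∧ x k ≠ y k := by
  classical
  have h' : ∃ k, x k ≠ y k := Function.ne_iff.1 h
  exact ⟨Nat.find h', fun j hj => not_not.1 (Nat.find_min h' hj), Nat.find_spec h'⟩

/-- The map `Φ` codes plane points by sequences of digits at geometric scale `ρ`: the distance of
two points is comparable to `ρ ^ k`, where `k` is the first place at which their codes differ. -/
structure IsGeometricCoding {n : ℕ} (ρ c C : ℝ) (Φ : (ℕ → Fin n) → ℂ) : Prop where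
  ratio_pos : 0 < ρ
  ratio_lt_one : ρ < 1
  lower_pos : 0 < c
  dist_ge : ∀ x y k, (∀ j < k, x j = y j) → x k ≠ y k → c * ρ ^ k ≤ dist (Φ x) (Φ y)
  dist_le : ∀ x y k, (∀ j < k, x j = y j) → dist (Φ x) (Φ y) ≤ C * ρ ^ k

namespace IsGeometricCoding

variable {n : ℕ} {ρ c C : ℝ} {Φ : (ℕ → Fin n) → ℂ}

theorem pow_rpow_eq (h : IsGeometricCoding ρ c C Φ) {s : ℝ} (hns : n * ρ ^ s = 1) (k : ℕ) :
    (ρ ^ k) ^ s = (n : ℝ)⁻¹ ^ k := by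
  rw [← Real.rpow_natCast, ← Real.rpow_mul h.ratio_pos.le, mul_comm,
    Real.rpow_mul h.ratio_pos.le, Real.rpow_natCast, eq_inv_of_mul_eq_one_right hns]

theorem injective (h : IsGeometricCoding ρ c C Φ) : Function.Injective Φ := by
  intro x y hxy
  by_contra hne
  obtain ⟨k, hk, hk'⟩ := exists_first_ne hne
  have := h.dist_ge x y k hk hk'
  rw [hxy, dist_self] at this
  exact absurd this (not_le.2 (mul_pos h.lower_pos (pow_pos h.ratio_pos k)))

/-- Reading the code of a point as a base-`n` expansion is Hölder continuous of exponent `s`. -/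
theorem abs_ofDigits_sub_le (h : IsGeometricCoding ρ c C Φ) {s : ℝ≥0} (hs : 0 < s)
    (hns : n * ρ ^ (s : ℝ) = 1) (x y : ℕ → Fin n) :
    |Real.ofDigits x - Real.ofDigits y| ≤ (c⁻¹ * dist (Φ x) (Φ y)) ^ (s : ℝ) := by
  have hc := h.lower_pos
  rcases eq_or_ne x y with rfl | hne
  · simp [NNReal.coe_ne_zero.2 hs.ne']
  obtain ⟨k, hk, hk'⟩ := exists_first_ne hne
  calc |Real.ofDigits x - Real.ofDigits y| ≤ ((n : ℝ) ^ k)⁻¹ :=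
        Real.abs_ofDigits_sub_ofDigits_le hk
    _ = (ρ ^ k) ^ (s : ℝ) := by rw [h.pow_rpow_eq hns, inv_pow]
    _ ≤ _ := by
        have := h.ratio_pos
        refine Real.rpow_le_rpow (by positivity) ?_ (NNReal.coe_nonneg s)
        rw [inv_mul_eq_div, le_div_iff₀ hc, mul_comm]
        exact h.dist_ge x y k hk hk'

open Topology in
/-- The range of a coding maps onto `[0, 1]` by a Hölder map, hence has dimension at least `s`. -/
theorem le_dimH_range (h : IsGeometricCoding ρ c C Φ) (hn : 1 < n) {s : ℝ≥0} (hs : 0 < s)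
    (hns : n * ρ ^ (s : ℝ) = 1) : (s : ℝ≥0∞) ≤ dimH (range Φ) := by
  have : NeZero n := ⟨by omega⟩
  let g : ℂ → ℝ := fun z => Real.ofDigits (Function.invFun Φ z)
  have hg : ∀ x, g (Φ x) = Real.ofDigits x := fun x => by
    simp only [g, Function.leftInverse_invFun h.injective x]
  have hold : HolderOnWith ((c⁻¹ ^ (s : ℝ)).toNNReal) s g (range Φ) := by
    rintro _ ⟨x, rfl⟩ _ ⟨y, rfl⟩
    have hc : 0 ≤ c⁻¹ := inv_nonneg.2 h.lower_pos.le
    rw [hg, hg, edist_dist, edist_dist, Real.dist_eq,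
      ENNReal.ofReal_rpow_of_nonneg dist_nonneg (NNReal.coe_nonneg s)]
    change _ ≤ ENNReal.ofReal _ * _
    rw [← ENNReal.ofReal_mul (Real.rpow_nonneg hc _), ← Real.mul_rpow hc dist_nonneg]
    exact ENNReal.ofReal_le_ofReal (h.abs_ofDigits_sub_le hs hns x y)
  have himage : Icc (0 : ℝ) 1 ⊆ g '' range Φ := by
    intro y hy
    obtain ⟨x, -, rfl⟩ := Real.ofDigits_SurjOn hn hy
    exact ⟨Φ x, mem_range_self x, hg x⟩
  have hone : dimH (Icc (0 : ℝ) 1) = 1 := by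
    have hnhds : Icc (0 : ℝ) 1 ∈ 𝓝 (2⁻¹ : ℝ) := Icc_mem_nhds (by norm_num) (by norm_num)
    simpa using Real.dimH_of_mem_nhds hnhds
  have hle : 1 ≤ dimH (range Φ) / s :=
    hone.symm.le.trans ((dimH_mono himage).trans (hold.dimH_image_le hs))
  simpa using (ENNReal.le_div_iff_mul_le (Or.inl (by simpa using hs.ne'))
    (Or.inl ENNReal.coe_ne_top)).1 hle

open MeasureTheory in
/-- Disjoint disks centred at coded points contain disjoint cylinders of comparable size, so that
the packing sums are bounded by the total mass of the Bernoulli measure. -/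
theorem packingContent_range_ne_top (h : IsGeometricCoding ρ c C Φ) (hn : 1 < n) {s : ℝ≥0}
    (hns : n * ρ ^ (s : ℝ) = 1) : packingContent s 1 (range Φ) ≠ ∞ := by
  classical
  have : NeZero n := ⟨by omega⟩
  have hρ := h.ratio_pos
  obtain ⟨K, hK1, hCK⟩ : ∃ K : ℝ, 1 ≤ K ∧ C ≤ K := ⟨max 1 C, le_max_left _ _, le_max_right _ _⟩
  have hK : 0 < K := one_pos.trans_le hK1
  let μ : Measure (ℕ → Fin n) :=
    Measure.infinitePi fun _ => ProbabilityTheory.uniformOn (univ : Set (Fin n))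
  have hprob : IsProbabilityMeasure (ProbabilityTheory.uniformOn (univ : Set (Fin n))) :=
    ProbabilityTheory.isProbabilityMeasure_uniformOn finite_univ univ_nonempty
  let cyl : (ℕ → Fin n) → ℕ → Set (ℕ → Fin n) :=
    fun u k => Set.pi (Finset.range k : Set ℕ) fun j => {u j}
  have hmeas : ∀ u k, MeasurableSet (cyl u k) := fun u k =>
    MeasurableSet.pi (Finset.countable_toSet _) fun _ _ => MeasurableSet.singleton _
  have hμcyl : ∀ u k, μ (cyl u k) = (n : ℝ≥0∞)⁻¹ ^ k := by
    intro u k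
    simp only [μ, cyl]
    rw [Measure.infinitePi_pi _ fun _ _ => MeasurableSet.singleton _]
    simp [ProbabilityTheory.uniformOn_univ]
  -- a disk of radius `r` centred at `Φ u` contains the image of a cylinder of mass `≈ r ^ s`
  have hdisk : ∀ u (r : ℝ), 0 < r → 2 * r ≤ 1 → ∃ k, cyl u k ⊆ Φ ⁻¹' closedBall (Φ u) r ∧
      ENNReal.ofReal (2 * r) ^ (s : ℝ) ≤
        ENNReal.ofReal ((2 * K) ^ (s : ℝ) * n) * (n : ℝ≥0∞)⁻¹ ^ k := by
    intro u r hr hr1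
    obtain ⟨k, hk1, hk2⟩ := exists_nat_pow_near_of_lt_one (x := r / K) (div_pos hr hK)
      ((div_le_one hK).2 (by linarith)) hρ h.ratio_lt_one
    refine ⟨k + 1, fun v hv => ?_, ?_⟩
    · have hd := h.dist_le v u (k + 1) fun j hj => by simpa using hv j (by simpa using hj)
      rw [lt_div_iff₀ hK] at hk1
      rw [mem_preimage, mem_closedBall]
      calc dist (Φ v) (Φ u) ≤ C * ρ ^ (k + 1) := hd
        _ ≤ K * ρ ^ (k + 1) := by gcongr
        _ ≤ r := by linarith
    · have hn0 : (0 : ℝ) < n := by exact_mod_cast (by omega : 0 < n)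
      rw [ENNReal.ofReal_rpow_of_nonneg (by positivity) (NNReal.coe_nonneg s),
        ← ENNReal.ofReal_natCast n,
        ← ENNReal.ofReal_inv_of_pos hn0, ← ENNReal.ofReal_pow (by positivity),
        ← ENNReal.ofReal_mul (by positivity)]
      refine ENNReal.ofReal_le_ofReal ?_
      rw [div_le_iff₀ hK] at hk2
      calc (2 * r) ^ (s : ℝ) ≤ (2 * K * ρ ^ k) ^ (s : ℝ) :=
            Real.rpow_le_rpow (by positivity) (by linarith) (NNReal.coe_nonneg s)
        _ = (2 * K) ^ (s : ℝ) * (n : ℝ)⁻¹ ^ k := by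
            rw [Real.mul_rpow (by positivity) (by positivity), h.pow_rpow_eq hns]
        _ = _ := by rw [pow_succ]; field_simp
  refine ne_top_of_le_ne_top (ENNReal.ofReal_ne_top (r := (2 * K) ^ (s : ℝ) * n))
    (iSup₂_le fun F hF => ?_)
  have hcode : ∀ p ∈ F, ∃ u k, cyl u k ⊆ Φ ⁻¹' closedBall p.1 p.2 ∧
      ENNReal.ofReal (2 * p.2) ^ (s : ℝ) ≤
        ENNReal.ofReal ((2 * K) ^ (s : ℝ) * n) * (n : ℝ≥0∞)⁻¹ ^ k := by
    intro p hp
    obtain ⟨u, hu⟩ := hF.center_mem p hp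
    obtain ⟨k, hk⟩ := hdisk u p.2 (hF.radius_pos p hp) (hF.diam_le p hp)
    rw [hu] at hk
    exact ⟨u, k, hk⟩
  choose! u k hsub hbound using hcode
  have hdisj : (F : Set (ℂ × ℝ)).PairwiseDisjoint fun p => cyl (u p) (k p) :=
    fun p hp q hq hpq => ((hF.disjoint hp hq hpq).preimage Φ).mono (hsub p hp) (hsub q hq)
  calc ∑ p ∈ F, ENNReal.ofReal (2 * p.2) ^ (s : ℝ)
      ≤ ∑ p ∈ F, ENNReal.ofReal ((2 * K) ^ (s : ℝ) * n) * μ (cyl (u p) (k p)) :=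
        Finset.sum_le_sum fun p hp => by rw [hμcyl]; exact hbound p hp
    _ = ENNReal.ofReal ((2 * K) ^ (s : ℝ) * n) * ∑ p ∈ F, μ (cyl (u p) (k p)) := by
        rw [Finset.mul_sum]
    _ ≤ ENNReal.ofReal ((2 * K) ^ (s : ℝ) * n) * 1 := by
        gcongr
        rw [← measure_biUnion_finset hdisj fun p _ => hmeas _ _]
        exact prob_le_one
    _ = _ := mul_one _

end IsGeometricCoding

/-! ### Self-similar sets with a complex contraction ratio -/

/-- The point `∑ ρ ^ j * t (x j)` with code `x` of the self-similar set generated by the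
contractions `z ↦ ρ * z + t a`. -/
noncomputable def codedPoint {ι : Type*} (t : ι → ℂ) (ρ : ℂ) (x : ℕ → ι) : ℂ :=
  ∑' j, ρ ^ j * t (x j)

section codedPoint

variable {ι : Type*} {t : ι → ℂ} {T : ℝ} {ρ : ℂ}

theorem norm_codedPoint_term_le (ht : ∀ a, ‖t a‖ ≤ T) {q : ℝ} (hρ : ‖ρ‖ ≤ q) (x : ℕ → ι) (j : ℕ) :
    ‖ρ ^ j * t (x j)‖ ≤ q ^ j * T := by
  rw [norm_mul, norm_pow]
  have := ht (x j)
  gcongr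
  exact pow_nonneg ((norm_nonneg ρ).trans hρ) j

theorem summable_codedPoint (ht : ∀ a, ‖t a‖ ≤ T) (hρ : ‖ρ‖ < 1) (x : ℕ → ι) :
    Summable fun j => ρ ^ j * t (x j) :=
  Summable.of_norm_bounded ((summable_geometric_of_lt_one (norm_nonneg ρ) hρ).mul_right T)
    (norm_codedPoint_term_le ht le_rfl x)

theorem norm_codedPoint_le (ht : ∀ a, ‖t a‖ ≤ T) {q : ℝ} (hρ : ‖ρ‖ ≤ q) (hq : q < 1)
    (x : ℕ → ι) : ‖codedPoint t ρ x‖ ≤ (1 - q)⁻¹ * T :=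
  tsum_of_norm_bounded ((hasSum_geometric_of_lt_one ((norm_nonneg ρ).trans hρ) hq).mul_right T)
    (norm_codedPoint_term_le ht hρ x)

theorem codedPoint_eq_sum_add (ht : ∀ a, ‖t a‖ ≤ T) (hρ : ‖ρ‖ < 1) (x : ℕ → ι) (k : ℕ) :
    codedPoint t ρ x = ∑ j ∈ Finset.range k, ρ ^ j * t (x j) +
      ρ ^ k * codedPoint t ρ fun j => x (j + k) := by
  rw [codedPoint, ← (summable_codedPoint ht hρ x).sum_add_tsum_nat_add k, codedPoint,
    ← tsum_mul_left]
  simp only [pow_add, mul_assoc, mul_left_comm]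

/-- Points whose codes share a prefix differ by the rescaled difference of the shifted points. -/
theorem codedPoint_sub (ht : ∀ a, ‖t a‖ ≤ T) (hρ : ‖ρ‖ < 1) {x y : ℕ → ι} {k : ℕ}
    (hxy : ∀ j < k, x j = y j) :
    codedPoint t ρ x - codedPoint t ρ y =
      ρ ^ k * (codedPoint t ρ (fun j => x (j + k)) - codedPoint t ρ fun j => y (j + k)) := by
  rw [codedPoint_eq_sum_add ht hρ x k, codedPoint_eq_sum_add ht hρ y k,
    Finset.sum_congr rfl fun j hj => by rw [hxy j (Finset.mem_range.1 hj)]]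
  ring

theorem continuous_codedPoint [TopologicalSpace ι] [DiscreteTopology ι] (ht : ∀ a, ‖t a‖ ≤ T)
    (hρ : ‖ρ‖ < 1) : Continuous (codedPoint t ρ) := by
  refine continuous_tsum (fun j => ?_)
    ((summable_geometric_of_lt_one (norm_nonneg ρ) hρ).mul_right T)
    fun j x => norm_codedPoint_term_le ht le_rfl x j
  exact continuous_const.mul ((continuous_of_discreteTopology (f := t)).comp (continuous_apply j))

theorem differentiableOn_codedPoint (ht : ∀ a, ‖t a‖ ≤ T) {U : Set ℂ} (hU : IsOpen U)
    {r : ℂ → ℂ} (hr : DifferentiableOn ℂ r U) {q : ℝ} (hq0 : 0 ≤ q) (hq : q < 1)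
    (hrq : ∀ w ∈ U, ‖r w‖ ≤ q)
    (x : ℕ → ι) : DifferentiableOn ℂ (fun w => codedPoint t (r w) x) U :=
  DifferentiableOn.congr (Complex.differentiableOn_tsum_of_summable_norm
    ((summable_geometric_of_lt_one hq0 hq).mul_right T)
    (fun j => (hr.pow j).mul_const (t (x j))) hU
    fun j w hw => norm_codedPoint_term_le ht (hrq w hw) x j) fun _ _ => rfl

end codedPoint

/-- The `m ^ 2` Gaussian integers in a square of side `m`, a set of digits with gaps at least `1`. -/
theorem exists_gaussian_digits (m : ℕ) : ∃ t : Fin (m * m) → ℂ,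
    (∀ a, ‖t a‖ ≤ 2 * m) ∧ ∀ a b, a ≠ b → 1 ≤ ‖t a - t b‖ := by
  refine ⟨fun a => ((finProdFinEquiv.symm a).1 : ℕ) + ((finProdFinEquiv.symm a).2 : ℕ) * Complex.I,
    fun a => ?_, fun a b hab => ?_⟩
  · have h1 : (((finProdFinEquiv.symm a).1 : ℕ) : ℝ) ≤ m := by exact_mod_cast (Fin.isLt _).le
    have h2 : (((finProdFinEquiv.symm a).2 : ℕ) : ℝ) ≤ m := by exact_mod_cast (Fin.isLt _).le
    refine (norm_add_le _ _).trans ?_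
    simp only [norm_mul, Complex.norm_natCast, Complex.norm_I, mul_one]
    linarith
  · have hne : finProdFinEquiv.symm a ≠ finProdFinEquiv.symm b := fun h =>
      hab (finProdFinEquiv.symm.injective h)
    obtain ⟨p, rfl⟩ := finProdFinEquiv.surjective a
    obtain ⟨q, rfl⟩ := finProdFinEquiv.surjective b
    simp only [Equiv.symm_apply_apply] at hne ⊢
    have hint : ∀ i j : Fin m, i ≠ j → (1 : ℝ) ≤ |((i : ℕ) : ℝ) - ((j : ℕ) : ℝ)| := by
      intro i j hij
      have hz : (((i : ℕ) : ℤ) - ((j : ℕ) : ℤ)) ≠ 0 := by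
        rw [sub_ne_zero]
        exact_mod_cast fun h => hij (Fin.ext h)
      exact_mod_cast Int.one_le_abs hz
    by_cases h1 : p.1 = q.1
    · have h2 : p.2 ≠ q.2 := fun h => hne (Prod.ext h1 h)
      refine (hint _ _ h2).trans (le_trans (le_of_eq ?_) (Complex.abs_im_le_norm _))
      simp
    · refine (hint _ _ h1).trans (le_trans (le_of_eq ?_) (Complex.abs_re_le_norm _))
      simp

/-- With contraction ratio small compared to the ratio of the gap to the size of the digits, the
first differing digit dominates, so that codes are geometric; this persists after a similarity. -/
theorem isGeometricCoding_codedPoint {n m : ℕ} {t : Fin n → ℂ} (hm : 2 ≤ m)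
    (ht : ∀ a, ‖t a‖ ≤ 2 * m) (hgap : ∀ a b, a ≠ b → 1 ≤ ‖t a - t b‖) {ρ : ℂ} (hρ0 : ρ ≠ 0)
    (hρ : ‖ρ‖ ≤ 1 / (8 * m)) (z : ℂ) {r : ℝ} (hr : 0 < r) :
    IsGeometricCoding ‖ρ‖ (r * (3 / 7)) (r * (8 * m)) fun x => z + r * codedPoint t ρ x := by
  have hm' : (2 : ℝ) ≤ m := by exact_mod_cast hm
  have h8 : ‖ρ‖ ≤ 1 / 8 := hρ.trans (by gcongr; linarith)
  have h1 : ‖ρ‖ < 1 := by linarith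
  have hbound : ∀ x y : ℕ → Fin n, ‖codedPoint t ρ x - codedPoint t ρ y‖ ≤ 32 / 7 * m := by
    intro x y
    have hx := norm_codedPoint_le ht h8 (by norm_num) x
    have hy := norm_codedPoint_le ht h8 (by norm_num) y
    have := norm_sub_le (codedPoint t ρ x) (codedPoint t ρ y)
    norm_num at hx hy
    linarith
  have hdist : ∀ x y : ℕ → Fin n, ∀ k, (∀ j < k, x j = y j) →
      dist (z + r * codedPoint t ρ x) (z + r * codedPoint t ρ y) = r * (‖ρ‖ ^ k *
        ‖codedPoint t ρ (fun j => x (j + k)) - codedPoint t ρ fun j => y (j + k)‖) := by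
    intro x y k hxy
    rw [dist_add_left, dist_eq_norm, ← mul_sub, codedPoint_sub ht h1 hxy, norm_mul, norm_mul,
      norm_pow, Complex.norm_of_nonneg hr.le]
  refine ⟨norm_pos_iff.2 hρ0, h1, by positivity, fun x y k hxy hk => ?_, fun x y k hxy => ?_⟩
  · rw [hdist x y k hxy, mul_assoc, mul_comm (3 / 7 : ℝ)]
    gcongr
    rw [codedPoint_eq_sum_add ht h1 (fun j => x (j + k)) 1,
      codedPoint_eq_sum_add ht h1 (fun j => y (j + k)) 1]
    simp only [Finset.sum_range_one, pow_zero, one_mul, zero_add, pow_one]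
    set u := codedPoint t ρ fun j => x (j + 1 + k)
    set v := codedPoint t ρ fun j => y (j + 1 + k)
    have huv : ‖ρ * (u - v)‖ ≤ 4 / 7 := by
      rw [norm_mul]
      calc ‖ρ‖ * ‖u - v‖ ≤ 1 / (8 * m) * (32 / 7 * m) := by
            gcongr
            exact hbound _ _
        _ = 4 / 7 := by field_simp; norm_num
    have heq : t (x k) + ρ * u - (t (y k) + ρ * v) = (t (x k) - t (y k)) - -(ρ * (u - v)) := by ring
    have := norm_sub_norm_le (t (x k) - t (y k)) (-(ρ * (u - v)))
    rw [norm_neg] at this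
    rw [heq]
    linarith [hgap _ _ hk]
  · rw [hdist x y k hxy, mul_assoc, mul_comm (8 * (m : ℝ))]
    gcongr
    exact (hbound _ _).trans (by linarith)

/-! ### Holomorphic families of self-similar sets -/

/-- If `Re α ≥ ε > 0` on the disk, then for `m` large the ratio `ρ = m ^ (-(1 + α))` is small
compared to `1 / m` throughout the disk, and `m ^ 2` contractions of ratio `ρ` generate a set of
dimension `log (m ^ 2) / log (1 / ‖ρ‖) = 2 / (1 + Re α)`. -/
theorem exists_holomorphic_coding {α : ℂ → ℂ} (hα : DifferentiableOn ℂ α (ball 0 1)) {ε : ℝ}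
    (hε : 0 < ε) (hαε : ∀ w ∈ ball (0 : ℂ) 1, ε ≤ (α w).re) (z : ℂ) {R : ℝ} (hR : 0 < R) :
    ∃ (n : ℕ) (Φ : ℂ → (ℕ → Fin n) → ℂ),
      (∀ x, DifferentiableOn ℂ (fun w => Φ w x) (ball 0 1)) ∧
      ∀ w ∈ ball (0 : ℂ) 1, Continuous (Φ w) ∧ Function.Injective (Φ w) ∧
        (∀ x, Φ w x ∈ closedBall z R) ∧
        ENNReal.ofReal (2 / (1 + (α w).re)) ≤ dimH (range (Φ w)) ∧
        packingContent (2 / (1 + (α w).re)).toNNReal 1 (range (Φ w)) ≠ ∞ := by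
  obtain ⟨m, hm8, hm⟩ : ∃ m : ℕ, 8 ≤ (m : ℝ) ^ ε ∧ 2 ≤ m :=
    ((((tendsto_rpow_atTop hε).comp tendsto_natCast_atTop_atTop).eventually_ge_atTop 8).and
      (Filter.eventually_ge_atTop 2)).exists
  have hm' : (2 : ℝ) ≤ m := by exact_mod_cast hm
  have hm0 : (0 : ℝ) < m := by linarith
  obtain ⟨t, ht, hgap⟩ := exists_gaussian_digits m
  let ρ : ℂ → ℂ := fun w => Complex.exp (-(1 + α w) * Real.log m)
  have hρd : DifferentiableOn ℂ ρ (ball 0 1) := by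
    have : DifferentiableOn ℂ (fun w => -(1 + α w) * Real.log m) (ball 0 1) :=
      ((hα.const_add 1).neg).mul_const _
    exact this.cexp
  have hρnorm : ∀ w, ‖ρ w‖ = (m : ℝ) ^ (-(1 + (α w).re)) := by
    intro w
    rw [Complex.norm_exp, Real.rpow_def_of_pos hm0]
    rw [Complex.re_mul_ofReal, Complex.neg_re, Complex.add_re, Complex.one_re, mul_comm]
  have hρle : ∀ w ∈ ball (0 : ℂ) 1, ‖ρ w‖ ≤ 1 / (8 * m) := by
    intro w hw
    calc ‖ρ w‖ ≤ (m : ℝ) ^ (-(1 + ε)) := by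
          rw [hρnorm]
          exact Real.rpow_le_rpow_of_exponent_le (by linarith) (by linarith [hαε w hw])
      _ = 1 / (m ^ ε * m) := by
          rw [Real.rpow_neg hm0.le, add_comm, Real.rpow_add hm0, Real.rpow_one, one_div]
      _ ≤ 1 / (8 * m) := by gcongr
  have h8 : ∀ w ∈ ball (0 : ℂ) 1, ‖ρ w‖ ≤ 1 / 8 := fun w hw =>
    (hρle w hw).trans (by gcongr; linarith)
  have hr : 0 < R / (4 * m) := by positivity
  refine ⟨m * m, fun w x => z + (R / (4 * m) : ℝ) * codedPoint t (ρ w) x, fun x => ?_,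
    fun w hw => ?_⟩
  · exact ((differentiableOn_codedPoint ht isOpen_ball hρd (by norm_num) (by norm_num) h8
      x).const_mul _).const_add _
  have hcod := isGeometricCoding_codedPoint hm ht hgap (Complex.exp_ne_zero _) (hρle w hw) z hr
  have hαw := hαε w hw
  have hs : 0 < 2 / (1 + (α w).re) := by apply div_pos <;> linarith
  have hn : 1 < m * m := by nlinarith
  have hns : ((m * m : ℕ) : ℝ) * ‖ρ w‖ ^ (((2 / (1 + (α w).re)).toNNReal : ℝ≥0) : ℝ) = 1 := by
    have h1 : -(1 + (α w).re) * (2 / (1 + (α w).re)) = -2 := by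
      have : 1 + (α w).re ≠ 0 := by linarith
      field_simp
    rw [Real.coe_toNNReal _ hs.le, hρnorm, ← Real.rpow_mul hm0.le, h1, Real.rpow_neg hm0.le]
    norm_num
    field_simp
  refine ⟨?_, hcod.injective, fun x => ?_,
    hcod.le_dimH_range hn (Real.toNNReal_pos.2 hs) hns, hcod.packingContent_range_ne_top hn hns⟩
  · exact continuous_const.add (continuous_const.mul
      (continuous_codedPoint ht (by linarith [h8 w hw])))
  · rw [mem_closedBall, dist_eq_norm, add_sub_cancel_left, norm_mul, Complex.norm_of_nonneg hr.le]
    have hx := norm_codedPoint_le ht (h8 w hw) (by norm_num) x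
    norm_num at hx
    calc R / (4 * m) * ‖codedPoint t (ρ w) x‖ ≤ R / (4 * m) * (4 * m) := by
          gcongr
          linarith
      _ = R := by field_simp

/-! ### Affine majorants of a concave function -/

/-- A supporting hyperplane of the hypograph, written as the real part of a holomorphic function. -/
theorem ConcaveOn.exists_differentiable_re_ge {U : Set ℂ} (hU : IsOpen U) {ψ : ℂ → ℝ}
    (hψ : ConcaveOn ℝ U ψ) {x : ℂ} (hx : x ∈ U) :
    ∃ α : ℂ → ℂ, Differentiable ℂ α ∧ (∀ z ∈ U, ψ z ≤ (α z).re) ∧ (α x).re = ψ x := by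
  have hcont : ContinuousOn ψ U := hψ.continuousOn hU
  have hopen : IsOpen {p : ℂ × ℝ | p.1 ∈ U ∧ p.2 < ψ p.1} := by
    have hV : IsOpen (Prod.fst ⁻¹' U : Set (ℂ × ℝ)) := hU.preimage continuous_fst
    have hc : ContinuousOn (fun p : ℂ × ℝ => ψ p.1 - p.2) (Prod.fst ⁻¹' U) :=
      (hcont.comp continuousOn_fst fun _ h => h).sub continuousOn_snd
    convert! hc.isOpen_inter_preimage hV (isOpen_Ioi (a := (0 : ℝ))) using 1
    ext p
    simp
  obtain ⟨f, hf⟩ := geometric_hahn_banach_open_point hψ.convex_strict_hypograph hopen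
    (x := (x, ψ x)) (fun h => lt_irrefl _ h.2)
  set L : ℂ → ℝ := fun z => f (z, 0) with hL
  set c : ℝ := f (0, 1) with hc
  have hsplit : ∀ (z : ℂ) (b : ℝ), f (z, b) = L z + b * c := by
    intro z b
    have : ((z, b) : ℂ × ℝ) = (z, 0) + b • ((0, 1) : ℂ × ℝ) := by simp
    rw [this, map_add, map_smul, smul_eq_mul]
  have hlt : ∀ z ∈ U, ∀ b < ψ z, L z + b * c < L x + ψ x * c := by
    intro z hz b hb
    rw [← hsplit, ← hsplit]
    exact hf _ ⟨hz, hb⟩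
  -- the hyperplane is not vertical, since `(x, ψ x - 1)` lies in the hypograph below `(x, ψ x)`
  have hcpos : 0 < c := by
    have := hlt x hx (ψ x - 1) (by linarith)
    linarith
  have hle : ∀ z ∈ U, L z + ψ z * c ≤ L x + ψ x * c := by
    intro z hz
    by_contra! h
    have h1 := hlt z hz (ψ z - (L z + ψ z * c - (L x + ψ x * c)) / c)
      (sub_lt_self _ (div_pos (by linarith) hcpos))
    rw [sub_mul, div_mul_cancel₀ _ hcpos.ne'] at h1
    linarith
  have hLre : ∀ z : ℂ, L z = z.re * L 1 + z.im * L Complex.I := by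
    intro z
    have : ((z, 0) : ℂ × ℝ) = z.re • ((1, 0) : ℂ × ℝ) + z.im • ((Complex.I, 0) : ℂ × ℝ) := by
      ext1
      · simp [Complex.re_add_im]
      · simp
    simp only [hL]
    rw [this, map_add, map_smul, map_smul, smul_eq_mul, smul_eq_mul]
  -- the real-linear functional `L` is the real part of multiplication by `L 1 - L I * I`
  refine ⟨fun z => ψ x + (L 1 - L Complex.I * Complex.I) * (x - z) / c, by fun_prop,
    fun z hz => ?_, by simp⟩
  have hre : ((ψ x + (L 1 - L Complex.I * Complex.I) * (x - z) / c : ℂ)).re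
      = ψ x + (L x - L z) / c := by
    rw [hLre x, hLre z, Complex.add_re, Complex.div_ofReal_re]
    simp
    ring
  rw [hre, ← sub_le_iff_le_add', le_div_iff₀ hcpos]
  linarith [hle z hz]

open Topology in
/-- By the Lindelöf property, countably many supporting hyperplanes, raised by positive constants,
have the given concave function as their infimum. -/
theorem ConcaveOn.exists_seq_differentiable_re_gt {U : Set ℂ} (hU : IsOpen U) (hne : U.Nonempty)
    {ψ : ℂ → ℝ} (hψ : ConcaveOn ℝ U ψ) :
    ∃ (α : ℕ → ℂ → ℂ) (ε : ℕ → ℝ), (∀ k, Differentiable ℂ (α k)) ∧ (∀ k, 0 < ε k) ∧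
      (∀ k, ∀ z ∈ U, ψ z + ε k ≤ (α k z).re) ∧
      ∀ z ∈ U, ∀ δ > 0, ∃ k, (α k z).re < ψ z + δ := by
  have hcont : ContinuousOn ψ U := hψ.continuousOn hU
  choose! β hβd hβle hβeq using fun x hx => hψ.exists_differentiable_re_ge hU (x := x) hx
  have hcover : ∀ j : ℕ, ∃ p : ℕ → ℂ, (∀ i, p i ∈ U) ∧
      ∀ z ∈ U, ∃ i, (β (p i) z).re < ψ z + 1 / (j + 1) := by
    intro j
    obtain ⟨T, hTU, hTc, hT⟩ := TopologicalSpace.countable_cover_nhdsWithin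
      (f := fun x => {z | (β x z).re < ψ z + 1 / (j + 1 : ℝ)}) (s := U) (fun x hx => by
        have h1 : ContinuousWithinAt (fun z => (β x z).re) U x :=
          (Complex.continuous_re.comp (hβd x hx).continuous).continuousWithinAt
        have h2 : ContinuousWithinAt (fun z => ψ z + 1 / (j + 1 : ℝ)) U x :=
          (hcont x hx).add continuousWithinAt_const
        refine h1.eventually_lt h2 ?_
        change (β x x).re < ψ x + 1 / (j + 1 : ℝ)
        rw [hβeq x hx]
        have : (0 : ℝ) < 1 / (j + 1) := by positivity
        linarith)
    have hTne : T.Nonempty := by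
      obtain ⟨z, hz⟩ := hne
      obtain ⟨x, hx, -⟩ := mem_iUnion₂.1 (hT hz)
      exact ⟨x, hx⟩
    obtain ⟨p, rfl⟩ := hTc.exists_eq_range hTne
    refine ⟨p, fun i => hTU (mem_range_self i), fun z hz => ?_⟩
    obtain ⟨x, ⟨i, rfl⟩, hi⟩ := mem_iUnion₂.1 (hT hz)
    exact ⟨i, hi⟩
  choose p hpU hp using hcover
  refine ⟨fun k z => β (p k.unpair.1 k.unpair.2) z + (1 / (k.unpair.1 + 1 : ℝ) : ℝ),
    fun k => 1 / (k.unpair.1 + 1 : ℝ), fun k => (hβd _ (hpU _ _)).add_const _,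
    fun k => by positivity, fun k z hz => ?_, fun z hz δ hδ => ?_⟩
  · rw [Complex.add_re, Complex.ofReal_re]
    gcongr
    exact hβle _ (hpU _ _) z hz
  · obtain ⟨j, hj⟩ := exists_nat_one_div_lt (half_pos hδ)
    obtain ⟨i, hi⟩ := hp j z hz
    refine ⟨Nat.pair j i, ?_⟩
    simp only [Nat.unpair_pair, Complex.add_re, Complex.ofReal_re]
    linarith

/-! ### Assembling countably many families -/

/-- Compact sets in disks that shrink to a point have, together with that point, a compact
union. -/
theorem IsCompact.insert_iUnion_of_closedBall {K : ℕ → Set ℂ} (hK : ∀ k, IsCompact (K k))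
    {z : ℕ → ℂ} {R : ℕ → ℝ} (hKz : ∀ k, K k ⊆ closedBall (z k) (R k)) {x : ℂ}
    (hlim : Filter.Tendsto (fun k => dist (z k) x + R k) Filter.atTop (nhds 0)) :
    IsCompact (insert x (⋃ k, K k)) := by
  refine isCompact_of_finite_subcover fun {ι} V hV hcov => ?_
  obtain ⟨i₀, hi₀⟩ := mem_iUnion.1 (hcov (mem_insert x _))
  obtain ⟨r, hr, hball⟩ := Metric.isOpen_iff.1 (hV i₀) x hi₀
  obtain ⟨N, hN⟩ := Filter.eventually_atTop.1 (hlim.eventually_lt_const hr)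
  have hcomp : IsCompact (⋃ k ∈ Finset.range N, K k) :=
    (Finset.range N).isCompact_biUnion fun k _ => hK k
  obtain ⟨F, hF⟩ := hcomp.elim_finite_subcover V hV
    ((iUnion₂_subset fun k _ => subset_iUnion K k).trans ((subset_insert x _).trans hcov))
  classical
  refine ⟨insert i₀ F, ?_⟩
  rw [Finset.set_biUnion_insert]
  rintro y (rfl | hy)
  · exact Or.inl hi₀
  obtain ⟨k, hk⟩ := mem_iUnion.1 hy
  by_cases hkN : k < N
  · exact Or.inr (hF (mem_iUnion₂.2 ⟨k, Finset.mem_range.2 hkN, hk⟩))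
  · refine Or.inl (hball (mem_ball.2 ?_))
    calc dist y x ≤ dist y (z k) + dist (z k) x := dist_triangle _ _ _
      _ ≤ R k + dist (z k) x := by
        gcongr
        exact hKz k hk
      _ < r := by
        rw [add_comm]
        exact hN k (not_lt.1 hkN)

/-- A holomorphic family of injections of a set of codes is a holomorphic motion of the image at
the base point. -/
theorem isHolomorphicMotion_of_injective {X : Type*} [Nonempty X] {Φ : ℂ → X → ℂ}
    (hd : ∀ x, DifferentiableOn ℂ (fun w => Φ w x) (ball 0 1))
    (hinj : ∀ w ∈ ball (0 : ℂ) 1, Function.Injective (Φ w)) :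
    IsHolomorphicMotion (range (Φ 0)) (fun w z => Φ w (Function.invFun (Φ 0) z)) ∧
      ∀ w, (fun z => Φ w (Function.invFun (Φ 0) z)) '' range (Φ 0) = range (Φ w) := by
  have hinv : ∀ x, Function.invFun (Φ 0) (Φ 0 x) = x :=
    Function.leftInverse_invFun (hinj 0 (mem_ball_self one_pos))
  refine ⟨⟨?_, ?_, ?_⟩, fun w => ?_⟩
  · rintro _ ⟨x, rfl⟩
    simpa only [hinv] using hd x
  · rintro w hw _ ⟨x, rfl⟩ _ ⟨y, rfl⟩ hxy
    simp only [hinv] at hxy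
    rw [hinj w hw hxy]
  · rintro _ ⟨x, rfl⟩
    simp only [hinv]
  · rw [← range_comp]
    congr 1
    ext x
    simp only [Function.comp_apply, hinv]

theorem disjoint_closedBall_two_pow {k l : ℕ} (hkl : k ≠ l) :
    Disjoint (closedBall ((2⁻¹ ^ k : ℝ) : ℂ) (2⁻¹ ^ k / 8))
      (closedBall ((2⁻¹ ^ l : ℝ) : ℂ) (2⁻¹ ^ l / 8)) := by
  wlog h : k < l generalizing k l
  · exact (this hkl.symm (lt_of_le_of_ne (not_lt.1 h) hkl.symm)).symm
  apply closedBall_disjoint_closedBall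
  rw [Complex.dist_of_im_eq (by rw [Complex.ofReal_im, Complex.ofReal_im]),
    Complex.ofReal_re, Complex.ofReal_re, Real.dist_eq]
  have h1 : (2⁻¹ : ℝ) ^ l ≤ 2⁻¹ ^ (k + 1) :=
    pow_le_pow_of_le_one (by norm_num) (by norm_num) h
  have h2 : (0 : ℝ) < 2⁻¹ ^ k := by positivity
  rw [pow_succ] at h1
  refine lt_of_lt_of_le ?_ (le_abs_self _)
  linarith

open Topology in
theorem corollary1p8 (ψ : ℂ → ℝ) (hψ : ConcaveOn ℝ (ball (0 : ℂ) 1) ψ)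
    (hψ_nonneg : ∀ w ∈ ball (0 : ℂ) 1, 0 ≤ ψ w) :
    ∃ (A : Set ℂ) (f : ℂ → ℂ → ℂ), IsCompact A ∧ IsHolomorphicMotion A f ∧
      ∀ w ∈ ball (0 : ℂ) 1,
        dimH (f w '' A) = ENNReal.ofReal (2 / (1 + ψ w)) ∧
        dimP (f w '' A) = ENNReal.ofReal (2 / (1 + ψ w)) := by
  obtain ⟨α, ε, hαd, hε, hαge, hαlt⟩ :=
    hψ.exists_seq_differentiable_re_gt isOpen_ball (nonempty_ball.2 one_pos)
  have hαε : ∀ k, ∀ w ∈ ball (0 : ℂ) 1, ε k ≤ (α k w).re := fun k w hw => by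
    linarith [hψ_nonneg w hw, hαge k w hw]
  choose n Φ hΦd hΦ using fun k : ℕ => exists_holomorphic_coding (hαd k).differentiableOn (hε k)
    (hαε k) ((2⁻¹ ^ k : ℝ) : ℂ) (R := 2⁻¹ ^ k / 8) (by positivity)
  -- the codes of all the self-similar sets, and one more for their accumulation point `0`
  let Ψ : ℂ → Option (Σ k, ℕ → Fin (n k)) → ℂ := fun w o => o.elim 0 fun p => Φ p.1 w p.2
  have hrange : ∀ w, range (Ψ w) = insert 0 (⋃ k, range (Φ k w)) := by
    intro w
    ext y
    simp [Ψ, Option.exists, eq_comm (a := (0 : ℂ))]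
  have hzero : ∀ k, (0 : ℂ) ∉ closedBall ((2⁻¹ ^ k : ℝ) : ℂ) (2⁻¹ ^ k / 8) := by
    intro k h
    have h2 : (0 : ℝ) < 2⁻¹ ^ k := by positivity
    rw [mem_closedBall, dist_zero_left, Complex.norm_of_nonneg h2.le] at h
    linarith
  have hinj : ∀ w ∈ ball (0 : ℂ) 1, Function.Injective (Ψ w) := by
    intro w hw
    rintro (_ | ⟨k, x⟩) (_ | ⟨l, y⟩) h
    · rfl
    · exact (hzero l (by simpa [← show 0 = Φ l w y from h] using (hΦ l w hw).2.2.1 y)).elim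
    · exact (hzero k (by simpa [show Φ k w x = 0 from h] using (hΦ k w hw).2.2.1 x)).elim
    · change Φ k w x = Φ l w y at h
      rcases eq_or_ne k l with rfl | hkl
      · rw [(hΦ k w hw).2.1 h]
      · refine (Set.disjoint_left.1 (disjoint_closedBall_two_pow hkl) ((hΦ k w hw).2.2.1 x) ?_).elim
        rw [h]
        exact (hΦ l w hw).2.2.1 y
  obtain ⟨hmotion, himage⟩ := isHolomorphicMotion_of_injective (Φ := Ψ) (by
    rintro (_ | ⟨k, x⟩)
    · exact differentiableOn_const 0
    · exact hΦd k x) hinj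
  have h0 : (0 : ℂ) ∈ ball (0 : ℂ) 1 := mem_ball_self one_pos
  refine ⟨range (Ψ 0), _, ?_, hmotion, fun w hw => ?_⟩
  · rw [hrange]
    refine IsCompact.insert_iUnion_of_closedBall (fun k => isCompact_range (hΦ k 0 h0).1)
      (z := fun k => ((2⁻¹ ^ k : ℝ) : ℂ)) (R := fun k => 2⁻¹ ^ k / 8)
      (fun k => range_subset_iff.2 (hΦ k 0 h0).2.2.1) ?_
    have hlim : Filter.Tendsto (fun k : ℕ => (2⁻¹ : ℝ) ^ k) Filter.atTop (𝓝 0) :=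
      tendsto_pow_atTop_nhds_zero_of_lt_one (by norm_num) (by norm_num)
    simpa using hlim.add (hlim.div_const 8)
  rw [himage w, hrange w]
  have hψw := hψ_nonneg w hw
  have hlower : ENNReal.ofReal (2 / (1 + ψ w)) ≤ dimH (insert 0 (⋃ k, range (Φ k w))) := by
    have hk : ∀ k, ENNReal.ofReal (2 / (1 + (α k w).re)) ≤ dimH (insert 0 (⋃ k, range (Φ k w))) :=
      fun k => (hΦ k w hw).2.2.2.1.trans
        (dimH_mono ((subset_iUnion (fun k => range (Φ k w)) k).trans (subset_insert _ _)))
    have hlim : Filter.Tendsto (fun δ : ℝ => ENNReal.ofReal (2 / (1 + (ψ w + δ)))) (𝓝[>] 0)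
        (𝓝 (ENNReal.ofReal (2 / (1 + ψ w)))) := by
      have hc : ContinuousAt (fun δ : ℝ => 2 / (1 + (ψ w + δ))) 0 :=
        continuousAt_const.div (by fun_prop) (by simp only [add_zero]; linarith)
      have := ENNReal.tendsto_ofReal hc.tendsto
      simp only [add_zero] at this
      exact this.mono_left nhdsWithin_le_nhds
    refine le_of_tendsto hlim ?_
    filter_upwards [self_mem_nhdsWithin] with δ hδ
    obtain ⟨k, hkδ⟩ := hαlt w hw δ hδ
    refine le_trans (ENNReal.ofReal_le_ofReal ?_) (hk k)
    have := hαε k w hw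
    have := hε k
    gcongr
    linarith
  have hupper : dimP (insert 0 (⋃ k, range (Φ k w))) ≤ ENNReal.ofReal (2 / (1 + ψ w)) := by
    have hunion : insert 0 (⋃ k, range (Φ k w)) =
        ⋃ j : ℕ, Nat.casesOn (motive := fun _ => Set ℂ) j {0} fun k => range (Φ k w) := by
      rw [← singleton_union]
      exact union_iUnion_nat_succ
        fun j : ℕ => Nat.casesOn (motive := fun _ => Set ℂ) j {0} fun k => range (Φ k w)
    rw [hunion]
    refine dimP_iUnion_le fun t ht j => ?_
    cases j with
    | zero => exact prePackingMeasure_eq_zero_of_lt ht (packingContent_singleton_ne_top _ 0)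
    | succ k =>
      refine prePackingMeasure_eq_zero_of_lt (lt_of_le_of_lt ?_ ht) (hΦ k w hw).2.2.2.2
      refine Real.toNNReal_le_toNNReal ?_
      have := hαge k w hw
      have := hε k
      gcongr
      linarith
  exact ⟨le_antisymm ((dimH_le_dimP _).trans hupper) hlower,
    le_antisymm hupper (hlower.trans (dimH_le_dimP _))⟩
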